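/- Let $\mathcal A$ be a $C^*$-algebra and let $H_{\mathcal A}=\{(x_n)_{n\in\mathbb N}\subset\mathcal A : \sum_n x_n^*x_n \text{ converges in norm}\}$ be the standard right Hilbert $\mathcal A$-module, with inner product $\langle x,y\rangle=\sum_n x_n^*y_n$ and norm $\|x\|=\|\langle x,x\rangle\|^{1/2}$. Let $B^a(H_{\mathcal A})$ be the set of bounded $\mathcal A$-linear operators on $H_{\mathcal A}$ that have an adjoint. A finitely generated Hilbert submodule of $H_{\mathcal A}$ is a closed submodule that is the linear span, over $\mathbb C$ and $\mathcal A$, of a finite set of its elements. For a submodule $L$ put $L^\perp=\{y : \langle x,y\rangle=0 \text{ for all } x\in L\}$. Let $\tilde{\mathcal M}\Phi_0^{gc}(H_{\mathcal A})$ be the class of all $T\in B^a(H_{\mathcal A})$ such that $\operatorname{Im}T$ is closed and there are finitely generated Hilbert submodules $N,\tilde N$ of $H_{\mathcal A}$ with $N\oplus\ker T\cong\tilde N\oplus(\operatorname{Im}T)^\perp$, where $\oplus$ is the external direct sum and $\cong$ means that there is a bijective $\mathcal A$-linear map that is bounded together with its inverse. Let $T\in\tilde{\mathcal M}\Phi_0^{gc}(H_{\mathcal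 A})$, and let $F\in B^a(H_{\mathcal A})$ be such that $\operatorname{Im}F$ is closed and finitely generated. Let $P$ be the orthogonal projection onto $(\ker F)^\perp$. Suppose that $\operatorname{Im}(T+F)$, $T(\ker F)$, $P(\ker T)$ and $P(\ker(T+F))$ are closed. Then $T+F\in\tilde{\mathcal M}\Phi_0^{gc}(H_{\mathcal A})$. -/

import Mathlib

open MulOpposite

noncomputable section

namespace HilbertModule

/-! ### The standard Hilbert module `H_A = ℓ²(A)` over a C⋆-algebra `A` -/

section Summability

variable {A : Type*} [NonUnitalCStarAlgebra A]

/-- Comparison test for series of positive elements of a C⋆-algebra. -/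
theorem summable_of_le [PartialOrder A] [StarOrderedRing A] {f g : ℕ → A}
    (hf : ∀ n, 0 ≤ f n) (hfg : ∀ n, f n ≤ g n) (hg : Summable g) : Summable f := by
  rw [summable_iff_vanishing_norm] at hg ⊢
  intro ε hε
  obtain ⟨s, hs⟩ := hg ε hε
  refine ⟨s, fun t ht => lt_of_le_of_lt ?_ (hs t ht)⟩
  exact CStarAlgebra.norm_le_norm_of_nonneg_of_le (Finset.sum_nonneg fun i _ => hf i)
    (Finset.sum_le_sum fun i _ => hfg i)

theorem summable_add {x y : ℕ → A} (hx : Summable fun n => star (x n) * x n)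
    (hy : Summable fun n => star (y n) * y n) :
    Summable fun n => star ((x + y) n) * (x + y) n := by
  let := CStarAlgebra.spectralOrder A
  have := CStarAlgebra.spectralOrderedRing A
  refine summable_of_le (fun n => star_mul_self_nonneg _) (fun n => ?_)
    ((hx.add hy).add (hx.add hy))
  have h : 0 ≤ star (x n - y n) * (x n - y n) := star_mul_self_nonneg _
  rw [← sub_nonneg]
  convert h using 1
  simp only [Pi.add_apply, star_add, star_sub, add_mul, mul_add, sub_mul, mul_sub]
  abel

theorem summable_smul (c : ℂ) {x : ℕ → A} (hx : Summable fun n => star (x n) * x n) :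
    Summable fun n => star ((c • x) n) * (c • x) n := by
  have := hx.const_smul (star c * c)
  refine this.congr fun n => ?_
  simp [star_smul, smul_mul_smul_comm]

theorem summable_mul_right (a : A) {x : ℕ → A} (hx : Summable fun n => star (x n) * x n) :
    Summable fun n => star (x n * a) * (x n * a) := by
  refine ((hx.mul_left (star a)).mul_right a).congr fun n => ?_
  simp [mul_assoc]

variable (A) in
/-- The sequences `(xₙ)` in `A` for which `∑ xₙ* xₙ` converges in norm. -/
def stdSubmodule : Submodule ℂ (ℕ → A) where
  carrier := {x | Summable fun n => star (x n) * x n}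
  add_mem' := summable_add
  zero_mem' := by simp [summable_zero]
  smul_mem' c _ hx := summable_smul c hx

end Summability

/-- The standard Hilbert module `H_A` over the (not necessarily unital) C⋆-algebra `A`. -/
def StdModule (A : Type*) [NonUnitalCStarAlgebra A] : Type _ := stdSubmodule A

namespace StdModule

variable {A : Type*} [NonUnitalCStarAlgebra A]

instance : AddCommGroup (StdModule A) := inferInstanceAs (AddCommGroup (stdSubmodule A))

instance : Module ℂ (StdModule A) := inferInstanceAs (Module ℂ (stdSubmodule A))

/-- The sequence of coordinates of an element of `H_A`. -/
def coords (x : StdModule A) : ℕ → A := x.1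

instance : CoeFun (StdModule A) fun _ => ℕ → A := ⟨coords⟩

@[ext] theorem ext {x y : StdModule A} (h : ∀ n, x n = y n) : x = y := Subtype.ext (funext h)

theorem summable (x : StdModule A) : Summable fun n => star (x n) * x n := x.2

@[simp] theorem add_apply (x y : StdModule A) (n : ℕ) : (x + y) n = x n + y n := rfl
@[simp] theorem zero_apply (n : ℕ) : (0 : StdModule A) n = 0 := rfl
@[simp] theorem smul_apply (c : ℂ) (x : StdModule A) (n : ℕ) : (c • x) n = c • x n := rfl

/-- The right action of `A` on `H_A`: `(x · a)ₙ = xₙ a`. -/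
instance : SMul Aᵐᵒᵖ (StdModule A) := ⟨fun a x => ⟨fun n => x n * a.unop, summable_mul_right _ x.2⟩⟩

@[simp] theorem op_smul_apply (a : Aᵐᵒᵖ) (x : StdModule A) (n : ℕ) :
    (a • x) n = x n * a.unop := rfl

theorem summable_inner (x y : StdModule A) : Summable fun n => star (x n) * y n := by
  have h1 := (summable_add x.2 y.2).sub (x.summable.add y.summable)
  have h2 := (summable_add x.2 (Complex.I • y).2).sub (x.summable.add (Complex.I • y).summable)
  have h3 := (h1.sub (h2.const_smul Complex.I)).const_smul (1 / 2 : ℂ)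
  refine h3.congr fun n => ?_
  change (1 / 2 : ℂ) • (star (x n + y n) * (x n + y n) - (star (x n) * x n + star (y n) * y n) -
    Complex.I • (star (x n + Complex.I • y n) * (x n + Complex.I • y n) -
      (star (x n) * x n + star (Complex.I • y n) * (Complex.I • y n)))) = star (x n) * y n
  have e1 : star (x n + y n) * (x n + y n) - (star (x n) * x n + star (y n) * y n)
      = star (x n) * y n + star (y n) * x n := by
    simp only [star_add, add_mul, mul_add]; abel
  have e2 : star (x n + Complex.I • y n) * (x n + Complex.I • y n) -
      (star (x n) * x n + star (Complex.I • y n) * (Complex.I • y n))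
      = Complex.I • (star (x n) * y n) - Complex.I • (star (y n) * x n) := by
    simp only [star_add, add_mul, mul_add, star_smul, smul_mul_assoc, mul_smul_comm]
    simp
    abel
  rw [e1, e2, smul_sub Complex.I, smul_smul, smul_smul, Complex.I_mul_I]
  module

/-- The `A`-valued inner product `⟨x, y⟩ = ∑ xₙ* yₙ` on `H_A`. -/
def ip (x y : StdModule A) : A := ∑' n, star (x n) * y n

/-- The norm `‖x‖ = ‖⟨x, x⟩‖^(1/2)`. -/
instance : Norm (StdModule A) := ⟨fun x => √‖ip x x‖⟩

/-- `H_A` is a Hilbert C⋆-module in the sense of Mathlib. A right `A`-module is there a module over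
`Aᵐᵒᵖ`, and the inner product takes its values in `Aᵐᵒᵖ`. -/
instance [PartialOrder A] [StarOrderedRing A] : CStarModule Aᵐᵒᵖ (StdModule A) where
  inner x y := op (ip x y)
  inner_add_right {x y z} := by
    rw [← op_add]
    congr 1
    rw [ip, ip, ip, ← (summable_inner x y).tsum_add (summable_inner x z)]
    simp [mul_add]
  inner_self_nonneg {x} := by
    rw [op_nonneg]
    exact tsum_nonneg fun n => star_mul_self_nonneg _
  inner_self {x} := by
    rw [op_eq_zero_iff]
    constructor
    · intro h
      have h0 := x.summable.hasSum
      rw [show ∑' n, star (x n) * x n = 0 from h] at h0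
      have := (hasSum_zero_iff_of_nonneg fun n => star_mul_self_nonneg (x n)).1 h0
      ext n
      exact (CStarRing.star_mul_self_eq_zero_iff _).1 (congrFun this n)
    · rintro rfl
      simp [ip]
  inner_op_smul_right {a x y} := by
    apply unop_injective
    change ip x (a • y) = ip x y * a.unop
    rw [ip, ip, ← (summable_inner x y).tsum_mul_right]
    simp [mul_assoc]
  inner_smul_right_complex {z x y} := by
    rw [← op_smul]
    congr 1
    rw [ip, ip, ← (summable_inner x y).tsum_const_smul]
    simp [mul_smul_comm]
  star_inner x y := by
    rw [← op_star]
    congr 1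
    rw [ip, ip, tsum_star]
    simp
  norm_eq_sqrt_norm_inner_self _ := rfl

theorem core : NormedSpace.Core ℂ (StdModule A) :=
  letI := CStarAlgebra.spectralOrder A
  haveI := CStarAlgebra.spectralOrderedRing A
  CStarModule.normedSpaceCore Aᵐᵒᵖ

instance : NormedAddCommGroup (StdModule A) := NormedAddCommGroup.ofCore core

instance : NormedSpace ℂ (StdModule A) := NormedSpace.ofCore core

end StdModule

/-- Scalars acting on the right: the opposite of `ℂ ⊕ A`, the algebra obtained from `A` by adjoining
a unit. A submodule over these scalars is a complex subspace that is closed under the right action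
of `A`, a linear map is a complex linear map that commutes with the right action of `A`, and
"finitely generated" means to be the linear span, over `ℂ` and `A`, of a finite set. When `A` is
unital, these are the usual right `A`-module notions. -/
abbrev RightScalars (A : Type*) [NonUnitalCStarAlgebra A] : Type _ := (Unitization ℂ A)ᵐᵒᵖ

variable {A : Type*} [NonUnitalCStarAlgebra A]

/-- The right action of `ℂ ⊕ A` on `H_A`: `x · (c + a) = c x + x a`. -/
instance : Module (RightScalars A) (StdModule A) where
  smul r x := r.unop.fst • x + op r.unop.snd • x
  one_smul x := by
    change (1 : Unitization ℂ A).fst • x + op (1 : Unitization ℂ A).snd • x = x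
    ext n; simp
  mul_smul r s x := by
    change (s.unop * r.unop).fst • x + op (s.unop * r.unop).snd • x
      = r.unop.fst • (s.unop.fst • x + op s.unop.snd • x)
        + op r.unop.snd • (s.unop.fst • x + op s.unop.snd • x)
    ext n
    simp only [StdModule.add_apply, StdModule.smul_apply, StdModule.op_smul_apply, unop_op,
      Unitization.fst_mul, Unitization.snd_mul, mul_add, add_mul, smul_add, smul_mul_assoc,
      mul_smul_comm, smul_smul, mul_assoc, mul_comm s.unop.fst]
    abel
  smul_zero r := by
    change r.unop.fst • (0 : StdModule A) + op r.unop.snd • (0 : StdModule A) = 0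
    ext n; simp
  smul_add r x y := by
    change r.unop.fst • (x + y) + op r.unop.snd • (x + y)
      = (r.unop.fst • x + op r.unop.snd • x) + (r.unop.fst • y + op r.unop.snd • y)
    ext n
    simp only [StdModule.add_apply, StdModule.smul_apply, StdModule.op_smul_apply, unop_op,
      smul_add, add_mul]
    abel
  add_smul r s x := by
    change (r.unop + s.unop).fst • x + op (r.unop + s.unop).snd • x
      = (r.unop.fst • x + op r.unop.snd • x) + (s.unop.fst • x + op s.unop.snd • x)
    ext n
    simp only [StdModule.add_apply, StdModule.smul_apply, StdModule.op_smul_apply, unop_op,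
      Unitization.fst_add, Unitization.snd_add, add_smul, mul_add]
    abel
  zero_smul x := by
    change (0 : Unitization ℂ A).fst • x + op (0 : Unitization ℂ A).snd • x = 0
    ext n; simp

theorem rightScalars_smul_def (r : RightScalars A) (x : StdModule A) :
    r • x = r.unop.fst • x + op r.unop.snd • x := rfl

/-! ### Orthogonality, adjointable operators, and the class `M̃Φ₀^gc(H_A)` -/

open StdModule

theorem ip_rightScalars_smul (r : RightScalars A) (x y : StdModule A) :
    ip x (r • y) = r.unop.fst • ip x y + ip x y * r.unop.snd := by
  have h := summable_inner x y
  rw [ip, ip, ← h.tsum_const_smul, ← h.tsum_mul_right,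
    ← (h.const_smul _).tsum_add (h.mul_right _)]
  simp [rightScalars_smul_def, mul_add, mul_assoc, mul_smul_comm]

theorem ip_add_right (x y z : StdModule A) : ip x (y + z) = ip x y + ip x z := by
  rw [ip, ip, ip, ← (summable_inner x y).tsum_add (summable_inner x z)]
  simp [mul_add]

/-- The orthogonal complement `L^⊥ = {y | ⟨x, y⟩ = 0 for all x ∈ L}`. -/
def orth (L : Submodule (RightScalars A) (StdModule A)) :
    Submodule (RightScalars A) (StdModule A) where
  carrier := {y | ∀ x ∈ L, ip x y = 0}
  add_mem' {y z} hy hz x hx := by simp [ip_add_right, hy x hx, hz x hx]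
  zero_mem' x _ := by simp [ip]
  smul_mem' r y hy x hx := by simp [ip_rightScalars_smul, hy x hx]

open Classical in
/-- The orthogonal projection onto `L`: it sends `x` to the point `y ∈ L` with `x - y ∈ L^⊥`
(and to `0` if there is none, which never happens when `H_A = L ⊕ L^⊥`). -/
def orthProj (L : Submodule (RightScalars A) (StdModule A)) (x : StdModule A) : StdModule A :=
  if h : ∃ y ∈ L, x - y ∈ orth L then h.choose else 0

theorem orthProj_eq {L : Submodule (RightScalars A) (StdModule A)} {x y : StdModule A}
    (hy : y ∈ L) (hxy : x - y ∈ orth L) : orthProj L x = y := by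
  let := CStarAlgebra.spectralOrder A
  have := CStarAlgebra.spectralOrderedRing A
  have h : ∃ y ∈ L, x - y ∈ orth L := ⟨y, hy, hxy⟩
  rw [orthProj, dif_pos h]
  have h1 : h.choose - y ∈ L := L.sub_mem h.choose_spec.1 hy
  have h2 : h.choose - y ∈ orth L := by
    have := (orth L).sub_mem hxy h.choose_spec.2
    rwa [sub_sub_sub_cancel_left] at this
  have h3 : op (ip (h.choose - y) (h.choose - y)) = 0 := by rw [h2 _ h1, op_zero]
  exact sub_eq_zero.1 ((CStarModule.inner_self (A := Aᵐᵒᵖ)).1 h3)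

/-- `T` has an adjoint; the operators with this property form `B^a(H_A)`. -/
def IsAdjointable (T : StdModule A →L[RightScalars A] StdModule A) : Prop :=
  ∃ S : StdModule A →L[RightScalars A] StdModule A, ∀ x y, ip (T x) y = ip x (S y)

/-- `N` is a finitely generated Hilbert submodule of `H_A`. -/
def IsFGHilbertSubmodule (N : Submodule (RightScalars A) (StdModule A)) : Prop :=
  IsClosed (N : Set (StdModule A)) ∧ N.FG

/-- The class `M̃Φ₀^gc(H_A)`: adjointable operators `T` with closed image such that
`N ⊕ ker T ≅ N' ⊕ (Im T)^⊥` for some finitely generated Hilbert submodules `N`, `N'` of `H_A`.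
The direct sums are external, and an isomorphism is a bijective module map that is bounded in both
directions. -/
def IsGenWeyl (T : StdModule A →L[RightScalars A] StdModule A) : Prop :=
  IsAdjointable T ∧ IsClosed (Set.range T) ∧
    ∃ N N' : Submodule (RightScalars A) (StdModule A),
      IsFGHilbertSubmodule N ∧ IsFGHilbertSubmodule N' ∧
        Nonempty ((N × LinearMap.ker T.toLinearMap) ≃L[RightScalars A]
          (N' × orth (LinearMap.range T.toLinearMap)))

end HilbertModule

end

open MulOpposite

noncomputable section

namespace HilbertModule

variable {A : Type*} [NonUnitalCStarAlgebra A]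

namespace StdModule

/-! Write K = ker F. On K the operators T and T + F agree, so ker T ∩ K = ker(T+F) ∩ K and T(K) =
(T+F)(K). Each of them differs from its restriction to K only by finitely generated pieces: ker T ≅
(ker T ∩ K) ⊕ R and T(K)^⊥ ≅ M ⊕ (Im T)^⊥, and likewise for T + F with R', M'
(`exists_ker_equiv_and_orth_equiv`). Adding R, M, R' to the given isomorphism N ⊕ ker T ≅ N' ⊕ (Im
T)^⊥ and regrouping turns it into one for T + F.

The pieces are finitely generated because F maps K^⊥ injectively onto Im F (`fg_orth_ker`): P embeds
R in K^⊥ with image P(ker T), and M is an image of K^⊥. Since a submodule of a finitely generated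
module need not be finitely generated, P(ker T) must be an orthogonal summand, which is where its
closedness enters.

All the splittings rest on one fact: an adjointable operator with closed range has complemented
kernel and range. It follows from `exists_apply_adjoint_eq`, the surjectivity of TT* on Im T,
obtained by a continuity argument along a + TT* for a ≥ 0. -/

@[simp] theorem sub_apply (x y : StdModule A) (n : ℕ) : (x - y) n = x n - y n := rfl

/-! ### Inner product and norm on `H_A` -/

theorem star_ip (x y : StdModule A) : star (ip x y) = ip y x := by
  simp [ip, tsum_star]

theorem ip_add_left (x y z : StdModule A) : ip (x + y) z = ip x z + ip y z := by
  rw [← star_ip, ip_add_right, star_add, star_ip, star_ip]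

@[simp] theorem ip_zero_right (x : StdModule A) : ip x 0 = 0 := by simp [ip]

theorem ip_sub_right (x y z : StdModule A) : ip x (y - z) = ip x y - ip x z := by
  rw [eq_sub_iff_add_eq, ← ip_add_right, sub_add_cancel]

theorem ip_sub_left (x y z : StdModule A) : ip (x - y) z = ip x z - ip y z := by
  rw [eq_sub_iff_add_eq, ← ip_add_left, sub_add_cancel]

theorem ip_smul_right (c : ℂ) (x y : StdModule A) : ip x (c • y) = c • ip x y := by
  rw [ip, ip, ← (summable_inner x y).tsum_const_smul]
  simp [mul_smul_comm]

theorem ip_comm_eq_zero {x y : StdModule A} : ip x y = 0 ↔ ip y x = 0 := by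
  rw [← star_ip, star_eq_zero]

theorem ip_self_eq_zero {x : StdModule A} : ip x x = 0 ↔ x = 0 := by
  let := CStarAlgebra.spectralOrder A
  have := CStarAlgebra.spectralOrderedRing A
  rw [← op_eq_zero_iff]
  exact CStarModule.inner_self (A := Aᵐᵒᵖ) (x := x)

theorem norm_sq (x : StdModule A) : ‖x‖ ^ 2 = ‖ip x x‖ :=
  Real.sq_sqrt (norm_nonneg _)

theorem norm_ip_le (x y : StdModule A) : ‖ip x y‖ ≤ ‖x‖ * ‖y‖ := by
  let := CStarAlgebra.spectralOrder A
  have := CStarAlgebra.spectralOrderedRing A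
  exact CStarModule.norm_inner_le (A := Aᵐᵒᵖ) (StdModule A)

/-- By Cauchy–Schwarz, ‖y‖² = ‖⟨y, x⟩‖ ≤ ‖y‖‖x‖. This is the contractivity criterion for
truncations, coordinate selections and orthogonal projections. -/
theorem norm_le_of_ip_self_eq {x y : StdModule A} (h : ip y y = ip y x) : ‖y‖ ≤ ‖x‖ := by
  rcases (norm_nonneg y).eq_or_lt with h0 | h0
  · rw [← h0]; exact norm_nonneg x
  · refine le_of_mul_le_mul_left ?_ h0
    rw [← sq, norm_sq, h]
    exact norm_ip_le y x

theorem ip_self_nonneg [PartialOrder A] [StarOrderedRing A] (x : StdModule A) : 0 ≤ ip x x :=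
  tsum_nonneg fun _ => star_mul_self_nonneg _

theorem ext_ip_left {x y : StdModule A} (h : ∀ z, ip z x = ip z y) : x = y := by
  rw [← sub_eq_zero, ← ip_self_eq_zero, ip_sub_right, h, sub_self]

theorem continuous_ip_right (x : StdModule A) : Continuous (ip x) :=
  AddMonoidHomClass.continuous_of_bound
    (AddMonoidHom.mk' (ip x) (ip_add_right x)) ‖x‖ (norm_ip_le x)

/-! ### Completeness -/

/-- The truncation of a sequence to a finite set of indices. -/
def truncate (s : Finset ℕ) (x : ℕ → A) : StdModule A :=
  ⟨fun n => if n ∈ s then x n else 0,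
    summable_of_ne_finset_zero (s := s) fun n hn => by simp [hn]⟩

@[simp] theorem truncate_apply (s : Finset ℕ) (x : ℕ → A) (n : ℕ) :
    truncate s x n = if n ∈ s then x n else 0 := rfl

theorem ip_truncate (s : Finset ℕ) (x : ℕ → A) (y : StdModule A) :
    ip (truncate s x) y = ∑ n ∈ s, star (x n) * y n := by
  rw [ip, tsum_eq_sum (s := s) fun n hn => by simp [hn]]
  exact Finset.sum_congr rfl fun n hn => by simp [hn]

theorem norm_truncate_sq (s : Finset ℕ) (x : ℕ → A) :
    ‖truncate s x‖ ^ 2 = ‖∑ n ∈ s, star (x n) * x n‖ := by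
  rw [norm_sq, ip_truncate]
  congr 1
  exact Finset.sum_congr rfl fun n hn => by simp [hn]

theorem norm_truncate_le (s : Finset ℕ) (x : StdModule A) : ‖truncate s x‖ ≤ ‖x‖ := by
  apply norm_le_of_ip_self_eq
  rw [ip_truncate, ip_truncate]
  exact Finset.sum_congr rfl fun n hn => by simp [hn]

theorem truncate_add (s : Finset ℕ) (x y : ℕ → A) :
    truncate s (x + y) = truncate s x + truncate s y := by
  ext n
  by_cases hn : n ∈ s <;> simp [hn]

theorem norm_apply_le (x : StdModule A) (n : ℕ) : ‖x n‖ ≤ ‖x‖ := by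
  have h := norm_truncate_sq {n} x
  rw [Finset.sum_singleton, CStarRing.norm_star_mul_self, ← sq] at h
  rw [← (sq_eq_sq₀ (norm_nonneg _) (norm_nonneg _)).1 h]
  exact norm_truncate_le _ x

instance : CompleteSpace (StdModule A) := by
  refine Metric.complete_of_cauchySeq_tendsto fun u hu => ?_
  have hc : ∀ n, CauchySeq fun k => u k n := fun n => by
    rw [Metric.cauchySeq_iff] at hu ⊢
    intro ε hε
    obtain ⟨K, hK⟩ := hu ε hε
    refine ⟨K, fun k hk l hl => lt_of_le_of_lt ?_ (hK k hk l hl)⟩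
    rw [dist_eq_norm, dist_eq_norm, ← sub_apply]
    exact norm_apply_le _ n
  choose v hv using fun n => cauchySeq_tendsto_of_complete (hc n)
  -- The bound is uniform in the finite set s; this yields both the summability of the
  -- coordinatewise limit v and the convergence to it in norm.
  have key : ∀ ε > 0, ∃ K, ∀ k ≥ K, ∀ s, ‖truncate s (v - (u k).coords)‖ ≤ ε := by
    intro ε hε
    obtain ⟨K, hK⟩ := Metric.cauchySeq_iff.1 hu ε hε
    refine ⟨K, fun k hk s => ?_⟩
    refine (sq_le_sq₀ (norm_nonneg _) hε.le).1 ?_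
    rw [norm_truncate_sq]
    have hlim : Filter.Tendsto (fun l => ‖∑ n ∈ s, star (u l n - u k n) * (u l n - u k n)‖)
        Filter.atTop (nhds ‖∑ n ∈ s, star (v n - u k n) * (v n - u k n)‖) :=
      (tendsto_finsetSum s fun n _ =>
        (((hv n).sub_const _).star).mul ((hv n).sub_const _)).norm
    refine le_of_tendsto hlim ?_
    filter_upwards [Filter.eventually_ge_atTop K] with l hl
    have h := norm_truncate_sq s (u l - u k)
    have h2 : ‖truncate s (u l - u k)‖ ≤ ε :=
      (norm_truncate_le s _).trans (by rw [← dist_eq_norm]; exact (hK l hl k hk).le)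
    calc _ = ‖truncate s (u l - u k)‖ ^ 2 := h.symm
      _ ≤ ε ^ 2 := by gcongr
  have hsum : Summable fun n => star (v n) * v n := by
    rw [summable_iff_vanishing_norm]
    intro ε hε
    -- A partial sum is the square of the norm of a truncation, and two truncations of size about δ
    -- are added, so √ε is halved.
    set δ := √ε / 2 with hδ
    have hδ0 : 0 < δ := by positivity
    obtain ⟨K, hK⟩ := key δ hδ0
    obtain ⟨s, hs⟩ := summable_iff_vanishing_norm.1 (u K).summable (δ ^ 2) (by positivity)
    refine ⟨s, fun t ht => ?_⟩
    have h1 := hs t ht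
    rw [← norm_truncate_sq, sq_lt_sq₀ (norm_nonneg _) hδ0.le] at h1
    have h2 : truncate t v = truncate t (v - (u K).coords) + truncate t (u K) := by
      rw [← truncate_add, sub_add_cancel]
    have h3 : ‖truncate t v‖ < √ε := by
      rw [h2]
      refine (norm_add_le _ _).trans_lt ?_
      have := hK K le_rfl t
      linarith
    rw [← norm_truncate_sq, ← Real.sq_sqrt hε.le]
    exact pow_lt_pow_left₀ h3 (norm_nonneg _) two_ne_zero
  let w : StdModule A := ⟨v, hsum⟩
  refine ⟨w, Metric.tendsto_atTop.2 fun ε hε => ?_⟩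
  obtain ⟨K, hK⟩ := key (ε / 2) (by positivity)
  refine ⟨K, fun k hk => lt_of_le_of_lt ?_ (half_lt_self hε)⟩
  rw [dist_comm, dist_eq_norm]
  refine (sq_le_sq₀ (norm_nonneg _) (by positivity)).1 ?_
  rw [norm_sq]
  refine le_of_tendsto (summable_inner (w - u k) (w - u k)).hasSum.norm (.of_forall fun s => ?_)
  have h := norm_truncate_sq s (v - (u k).coords)
  refine h.symm.trans_le ?_
  gcongr
  exact hK k hk s

/-! ### Scalars -/

/-- Module maps can thereby be regarded as bounded complex-linear operators, to which Banach space
theory applies. -/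
instance : IsScalarTower ℂ (RightScalars A) (StdModule A) where
  smul_assoc c r x := by
    ext n
    simp [rightScalars_smul_def, smul_smul, mul_smul_comm]

/-! ### Reindexing -/

/-- The module map on `H_A` that selects the coordinates with index in the range of `e`. -/
def select {e : ℕ → ℕ} (he : e.Injective) : StdModule A →ₗ[RightScalars A] StdModule A where
  toFun x := ⟨fun n => x (e n), x.summable.comp_injective he⟩
  map_add' _ _ := rfl
  map_smul' _ _ := rfl

@[simp] theorem select_apply {e : ℕ → ℕ} (he : e.Injective) (x : StdModule A) (n : ℕ) :
    select he x n = x (e n) := rfl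

theorem extend_eq_zero (e : ℕ → ℕ) (x : ℕ → A) {n : ℕ} (hn : n ∉ Set.range e) :
    Function.extend e x 0 n = 0 :=
  Function.extend_apply' _ _ _ (by simpa using hn)

/-- The module map on `H_A` that moves the coordinate of index `n` to the index `e n`. -/
def spread {e : ℕ → ℕ} (he : e.Injective) : StdModule A →ₗ[RightScalars A] StdModule A where
  toFun x := ⟨Function.extend e x 0, by
    refine (he.summable_iff fun n hn => ?_).1 (x.summable.congr fun n => ?_)
    · rw [extend_eq_zero e x hn, mul_zero]
    · simp [he.extend_apply]⟩
  map_add' x y := by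
    ext n
    change Function.extend e (x + y).coords 0 n
      = Function.extend e x.coords 0 n + Function.extend e y.coords 0 n
    by_cases hn : n ∈ Set.range e
    · obtain ⟨m, rfl⟩ := hn
      simp [he.extend_apply]
    · simp [extend_eq_zero e _ hn]
  map_smul' r x := by
    ext n
    change Function.extend e (r • x).coords 0 n
      = r.unop.fst • Function.extend e x.coords 0 n + Function.extend e x.coords 0 n * r.unop.snd
    by_cases hn : n ∈ Set.range e
    · obtain ⟨m, rfl⟩ := hn
      simp [he.extend_apply, rightScalars_smul_def]
    · simp [extend_eq_zero e _ hn]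

@[simp] theorem spread_apply_self {e : ℕ → ℕ} (he : e.Injective) (x : StdModule A) (n : ℕ) :
    spread he x (e n) = x n := he.extend_apply _ _ _

theorem spread_apply_of_notMem {e : ℕ → ℕ} (he : e.Injective) (x : StdModule A) {n : ℕ}
    (hn : n ∉ Set.range e) : spread he x n = 0 := extend_eq_zero e _ hn

@[simp] theorem select_spread {e : ℕ → ℕ} (he : e.Injective) (x : StdModule A) :
    select he (spread he x) = x := by ext n; simp

theorem ip_spread {e : ℕ → ℕ} (he : e.Injective) (x y : StdModule A) :
    ip (spread he x) y = ip x (select he y) := by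
  rw [ip, ip, ← he.tsum_eq]
  · simp
  · intro n hn
    by_contra h
    simp [spread_apply_of_notMem he x h] at hn

theorem continuous_spread {e : ℕ → ℕ} (he : e.Injective) :
    Continuous (spread (A := A) he) := by
  refine AddMonoidHomClass.continuous_of_bound (spread he) 1 fun x => ?_
  rw [one_mul, ← sq_le_sq₀ (norm_nonneg _) (norm_nonneg _), norm_sq, norm_sq, ip_spread,
    select_spread]

theorem continuous_select {e : ℕ → ℕ} (he : e.Injective) :
    Continuous (select (A := A) he) := by
  refine AddMonoidHomClass.continuous_of_bound (select he) 1 fun x => ?_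
  rw [one_mul]
  calc ‖select he x‖ = ‖spread he (select he x)‖ := by
        rw [← sq_eq_sq₀ (norm_nonneg _) (norm_nonneg _), norm_sq, norm_sq, ip_spread,
          select_spread]
    _ ≤ ‖x‖ := norm_le_of_ip_self_eq (by rw [ip_spread, ip_spread, select_spread])

end StdModule

open StdModule

/-! ### Operators that are bounded below along a half-line -/

/-- The lower bound gives ‖(S + a)⁻¹‖ ≤ 1/c, so S + b = (S + a)(1 - (a - b)(S + a)⁻¹) is invertible
by a Neumann series. -/
theorem isUnit_add_smul_one_of_bounded_below {E : Type*} [NormedAddCommGroup E] [NormedSpace ℂ E]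
    [CompleteSpace E] {S : E →L[ℂ] E} {c : ℝ} (hc : 0 < c)
    {a b : ℝ} (hS : ∀ x, c * ‖x‖ ≤ ‖(S + (a : ℂ) • (1 : E →L[ℂ] E)) x‖) (hab : |a - b| < c)
    (ha : IsUnit (S + (a : ℂ) • (1 : E →L[ℂ] E))) : IsUnit (S + (b : ℂ) • (1 : E →L[ℂ] E)) := by
  obtain ⟨u, hu⟩ := ha
  have hinv : ‖(↑u⁻¹ : E →L[ℂ] E)‖ ≤ c⁻¹ := by
    refine ContinuousLinearMap.opNorm_le_bound _ (by positivity) fun y => ?_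
    have h := hS ((↑u⁻¹ : E →L[ℂ] E) y)
    rw [← hu, ← mul_apply_eq_comp, Units.mul_inv, one_apply_eq_self] at h
    rwa [← div_eq_inv_mul, le_div_iff₀ hc, mul_comm]
  have hlt : ‖((a - b : ℝ) : ℂ) • (↑u⁻¹ : E →L[ℂ] E)‖ < 1 := by
    rw [norm_smul, Complex.norm_real, Real.norm_eq_abs]
    calc |a - b| * ‖(↑u⁻¹ : E →L[ℂ] E)‖ ≤ |a - b| * c⁻¹ := by gcongr
      _ < c * c⁻¹ := by gcongr
      _ = 1 := mul_inv_cancel₀ hc.ne'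
  have h := u.isUnit.mul (isUnit_one_sub_of_norm_lt_one hlt)
  convert h using 1
  rw [mul_sub, mul_one, mul_smul_comm, Units.mul_inv, hu]
  push_cast
  module

/-- Continuity method: S + a is invertible for large a, and the uniform lower bound carries
invertibility down to a = 0 in steps of fixed length. -/
theorem surjective_of_bounded_below {E : Type*} [NormedAddCommGroup E] [NormedSpace ℂ E]
    [CompleteSpace E] {S : E →L[ℂ] E} {c : ℝ} (hc : 0 < c)
    (hS : ∀ a : ℝ, 0 ≤ a → ∀ x, c * ‖x‖ ≤ ‖(S + (a : ℂ) • (1 : E →L[ℂ] E)) x‖) :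
    Function.Surjective S := by
  set M : ℝ := ‖S‖ + 1 with hM
  have hM0 : 0 < M := by positivity
  have hMc : (M : ℂ) ≠ 0 := by exact_mod_cast hM0.ne'
  have hstart : IsUnit (S + (M : ℂ) • (1 : E →L[ℂ] E)) := by
    have hlt : ‖-((M : ℂ)⁻¹ • S)‖ < 1 := by
      rw [norm_neg, norm_smul, norm_inv, Complex.norm_real, Real.norm_of_nonneg hM0.le,
        ← div_eq_inv_mul, div_lt_one hM0]
      linarith
    have h := (isUnit_one_sub_of_norm_lt_one hlt).smul (Units.mk0 (M : ℂ) hMc)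
    convert h using 1
    rw [Units.smul_mk0, sub_neg_eq_add, smul_add, smul_smul, mul_inv_cancel₀ hMc, one_smul,
      add_comm]
  -- Steps of c/2 stay below the admissible length c; cutting off at 0 keeps the parameter where the
  -- lower bound is assumed.
  have hall : ∀ n : ℕ,
      IsUnit (S + ((max 0 (M - n * (c / 2)) : ℝ) : ℂ) • (1 : E →L[ℂ] E)) := by
    intro n
    induction n with
    | zero => simpa [max_eq_right hM0.le] using hstart
    | succ n ih =>
      refine isUnit_add_smul_one_of_bounded_below hc (hS _ (le_max_left _ _)) ?_ ih
      refine (abs_max_sub_max_le_max _ _ _ _).trans_lt (max_lt (by simpa using hc) ?_)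
      rw [abs_lt]
      push_cast
      constructor <;> linarith
  obtain ⟨n, hn⟩ := exists_nat_ge (M / (c / 2))
  have h := hall n
  rw [div_le_iff₀ (by positivity)] at hn
  rw [max_eq_left (by linarith), Complex.ofReal_zero, zero_smul, add_zero] at h
  exact ((ContinuousLinearMap.isUnit_iff_bijective).1 h).2

/-! ### Orthogonally complemented submodules -/

theorem isClosed_orth (L : Submodule (RightScalars A) (StdModule A)) :
    IsClosed (orth L : Set (StdModule A)) := by
  have : (orth L : Set (StdModule A)) = ⋂ x ∈ L, ip x ⁻¹' {0} := by
    ext y; simp [orth]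
  rw [this]
  exact isClosed_biInter fun x _ => isClosed_singleton.preimage (continuous_ip_right x)

theorem orth_anti {L M : Submodule (RightScalars A) (StdModule A)} (h : L ≤ M) :
    orth M ≤ orth L := fun _ hy x hx => hy x (h hx)

theorem le_orth_orth (L : Submodule (RightScalars A) (StdModule A)) : L ≤ orth (orth L) :=
  fun x hx _ hy => ip_comm_eq_zero.1 (hy x hx)

theorem eq_zero_of_mem_orth {L : Submodule (RightScalars A) (StdModule A)} {x : StdModule A}
    (hx : x ∈ L) (hx' : x ∈ orth L) : x = 0 := ip_self_eq_zero.1 (hx' x hx)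

/-- `H_A = L ⊕ L^⊥`. -/
def IsOrthCompl (L : Submodule (RightScalars A) (StdModule A)) : Prop :=
  ∀ x, ∃ y ∈ L, x - y ∈ orth L

namespace IsOrthCompl

variable {L M : Submodule (RightScalars A) (StdModule A)}

theorem orthProj_mem (h : IsOrthCompl L) (x : StdModule A) : orthProj L x ∈ L := by
  obtain ⟨y, hy, hxy⟩ := h x
  rwa [orthProj_eq hy hxy]

theorem sub_orthProj_mem (h : IsOrthCompl L) (x : StdModule A) :
    x - orthProj L x ∈ HilbertModule.orth L := by
  obtain ⟨y, hy, hxy⟩ := h x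
  rwa [orthProj_eq hy hxy]

theorem ip_orthProj (h : IsOrthCompl L) (x y : StdModule A) :
    ip (orthProj L x) y = ip x (orthProj L y) := by
  have h1 : ip (orthProj L x) (y - orthProj L y) = 0 :=
    h.sub_orthProj_mem y _ (h.orthProj_mem x)
  have h2 : ip (x - orthProj L x) (orthProj L y) = 0 :=
    ip_comm_eq_zero.1 (h.sub_orthProj_mem x _ (h.orthProj_mem y))
  rw [ip_sub_right, sub_eq_zero] at h1
  rw [ip_sub_left, sub_eq_zero] at h2
  rw [h1, h2]

/-- The orthogonal projection onto a complemented submodule, as a continuous module map. -/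
def proj (h : IsOrthCompl L) : StdModule A →L[RightScalars A] StdModule A :=
  let f : StdModule A →ₗ[RightScalars A] StdModule A :=
    { toFun := orthProj L
      map_add' := fun x y => orthProj_eq (L.add_mem (h.orthProj_mem x) (h.orthProj_mem y)) (by
        rw [add_sub_add_comm]
        exact Submodule.add_mem _ (h.sub_orthProj_mem x) (h.sub_orthProj_mem y))
      map_smul' := fun r x => orthProj_eq (L.smul_mem r (h.orthProj_mem x)) (by
        rw [RingHom.id_apply, ← smul_sub]
        exact Submodule.smul_mem _ r (h.sub_orthProj_mem x)) }
  ⟨f, AddMonoidHomClass.continuous_of_bound f 1 fun x => by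
    rw [one_mul]
    refine norm_le_of_ip_self_eq ?_
    have h1 := h.sub_orthProj_mem x _ (h.orthProj_mem x)
    rw [ip_sub_right, sub_eq_zero] at h1
    exact h1.symm⟩

@[simp] theorem proj_apply (h : IsOrthCompl L) (x : StdModule A) : h.proj x = orthProj L x := rfl

theorem orthProj_of_mem {x : StdModule A} (hx : x ∈ L) : orthProj L x = x :=
  orthProj_eq hx (by simp)

theorem orthProj_of_mem_orth {x : StdModule A} (hx : x ∈ HilbertModule.orth L) :
    orthProj L x = 0 :=
  orthProj_eq L.zero_mem (by simpa using hx)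

protected theorem orth (h : IsOrthCompl L) : IsOrthCompl (HilbertModule.orth L) := fun x =>
  ⟨x - orthProj L x, h.sub_orthProj_mem x, by
    rw [sub_sub_cancel]
    exact le_orth_orth L (h.orthProj_mem x)⟩

theorem orthProj_orth (h : IsOrthCompl L) (x : StdModule A) :
    orthProj (HilbertModule.orth L) x = x - orthProj L x :=
  orthProj_eq (h.sub_orthProj_mem x) (by
    rw [sub_sub_cancel]
    exact le_orth_orth L (h.orthProj_mem x))

theorem orth_orth (h : IsOrthCompl L) : HilbertModule.orth (HilbertModule.orth L) = L := by
  refine le_antisymm (fun x hx => ?_) (le_orth_orth L)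
  have := eq_zero_of_mem_orth (h.sub_orthProj_mem x)
    (Submodule.sub_mem _ hx (le_orth_orth L (h.orthProj_mem x)))
  rw [sub_eq_zero.1 this]
  exact h.orthProj_mem x

theorem fg_of_le (h : IsOrthCompl L) (hLM : L ≤ M) (hM : M.FG) : L.FG := by
  have : L = M.map h.proj.toLinearMap := by
    refine le_antisymm (fun x hx => ⟨x, hLM hx, orthProj_of_mem hx⟩) ?_
    rintro _ ⟨x, -, rfl⟩
    exact h.orthProj_mem x
  rw [this]
  exact hM.map _

/-- A submodule that contains a complemented submodule `L` is the direct sum of `L` and a part of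
the complement of `L`. -/
def splitting (h : IsOrthCompl L) (hLM : L ≤ M) :
    M ≃L[RightScalars A] L × (M ⊓ HilbertModule.orth L : Submodule (RightScalars A) _) where
  toFun x := (⟨h.proj x, h.orthProj_mem x⟩,
    ⟨x - h.proj x, M.sub_mem x.2 (hLM (h.orthProj_mem x)), h.sub_orthProj_mem x⟩)
  invFun p := ⟨p.1 + p.2, M.add_mem (hLM p.1.2) p.2.2.1⟩
  map_add' x y := by
    ext1 <;> apply Subtype.ext
    · exact map_add h.proj (x : StdModule A) y
    · change (x + y : StdModule A) - h.proj (x + y) = _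
      rw [map_add]
      exact add_sub_add_comm _ _ _ _
  map_smul' r x := by
    ext1 <;> apply Subtype.ext
    · exact map_smul h.proj r (x : StdModule A)
    · change r • (x : StdModule A) - h.proj (r • (x : StdModule A)) = _
      rw [map_smul]
      exact (smul_sub r _ _).symm
  left_inv x := by simp
  right_inv p := by
    have h1 : h.proj (p.1 + p.2 : StdModule A) = p.1 := by
      rw [map_add, proj_apply, proj_apply, orthProj_of_mem p.1.2, orthProj_of_mem_orth p.2.2.2,
        add_zero]
    ext1 <;> apply Subtype.ext
    · exact h1
    · simp only [h1, add_sub_cancel_left]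
  continuous_toFun := by
    have := h.proj.continuous
    fun_prop
  continuous_invFun := by fun_prop

end IsOrthCompl

/-! ### Adjointable operators with closed range -/

/-- The operators `T` and `S` are adjoint to each other. -/
def IsAdjointPair (T S : StdModule A →L[RightScalars A] StdModule A) : Prop :=
  ∀ x y, ip (T x) y = ip x (S y)

namespace IsAdjointPair

variable {T S T' S' : StdModule A →L[RightScalars A] StdModule A}

theorem symm (h : IsAdjointPair T S) : IsAdjointPair S T := fun x y => by
  rw [← star_ip, ← h, star_ip]

theorem add (h : IsAdjointPair T S) (h' : IsAdjointPair T' S') :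
    IsAdjointPair (T + T') (S + S') := fun x y => by
  simp [ip_add_left, ip_add_right, h x y, h' x y]

theorem comp (h : IsAdjointPair T S) (h' : IsAdjointPair T' S') :
    IsAdjointPair (T.comp T') (S'.comp S) := fun x y => by
  simp [h _ y, h' x _]

theorem ker_eq_orth_range (h : IsAdjointPair T S) :
    LinearMap.ker S.toLinearMap = orth (LinearMap.range T.toLinearMap) := by
  ext y
  constructor
  · rintro hy _ ⟨x, rfl⟩
    change S y = 0 at hy
    change ip (T x) y = 0
    rw [h, hy, ip_zero_right]
  · intro hy
    refine ext_ip_left fun z => ?_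
    change ip z (S y) = _
    rw [← h, ip_zero_right]
    exact hy _ ⟨z, rfl⟩

/-- The operator TS on the Banach space Im T is surjective, because a + TS is bounded below there
uniformly in a ≥ 0. -/
theorem exists_apply_adjoint_eq (h : IsAdjointPair T S) (hT : IsClosed (Set.range T))
    (x : StdModule A) : ∃ z, T (S z) = T x := by
  let T₀ : StdModule A →L[ℂ] StdModule A := T.restrictScalars ℂ
  let S₀ : StdModule A →L[ℂ] StdModule A := S.restrictScalars ℂ
  let V : Submodule ℂ (StdModule A) := LinearMap.range T₀.toLinearMap
  have hV : IsClosed (V : Set (StdModule A)) := hT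
  have : CompleteSpace V := hV.completeSpace_coe
  let f : StdModule A →L[ℂ] V := T₀.codRestrict V fun x => ⟨x, rfl⟩
  have hf : Function.Surjective f := by
    rintro ⟨_, x, rfl⟩
    exact ⟨x, rfl⟩
  obtain ⟨C, hC, hpre⟩ := f.exists_preimage_norm_le hf
  -- With a preimage x of y bounded by the open mapping theorem, ‖y‖² = ‖⟨x, Sy⟩‖ ≤ C‖y‖‖Sy‖.
  have hS : ∀ y : V, ‖(y : StdModule A)‖ ≤ C * ‖S y‖ := by
    intro y
    obtain ⟨x, hx, hxC⟩ := hpre y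
    have hx' : T x = y := congrArg Subtype.val hx
    rcases (norm_nonneg (y : StdModule A)).eq_or_lt with h0 | h0
    · rw [← h0]; positivity
    refine le_of_mul_le_mul_left ?_ h0
    calc ‖(y : StdModule A)‖ * ‖(y : StdModule A)‖ = ‖ip (T x) y‖ := by rw [hx', ← norm_sq, sq]
      _ ≤ ‖x‖ * ‖S y‖ := by rw [h]; exact norm_ip_le _ _
      _ ≤ (C * ‖(y : StdModule A)‖) * ‖S y‖ := by gcongr; exact hxC
      _ = ‖(y : StdModule A)‖ * (C * ‖S y‖) := by ring
  -- Pairing with w gives ⟨Sw, Sw⟩ + a⟨w, w⟩; the second term is positive, so discarding it can only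
  -- decrease the norm.
  have hbelow : ∀ a : ℝ, 0 ≤ a → ∀ y : V, (C ^ 2)⁻¹ * ‖y‖
      ≤ ‖((f ∘L S₀ ∘L V.subtypeL) + (a : ℂ) • (1 : V →L[ℂ] V)) y‖ := by
    let := CStarAlgebra.spectralOrder A
    have := CStarAlgebra.spectralOrderedRing A
    intro a ha y
    change (C ^ 2)⁻¹ * ‖(y : StdModule A)‖ ≤ ‖T (S y) + (a : ℂ) • (y : StdModule A)‖
    set w : StdModule A := y.1 with hw
    rcases (norm_nonneg w).eq_or_lt with h0 | h0
    · rw [← h0, mul_zero]; exact norm_nonneg _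
    refine le_of_mul_le_mul_left ?_ h0
    have e : ip w (T (S w) + (a : ℂ) • w) = ip (S w) (S w) + (a : ℂ) • ip w w := by
      rw [ip_add_right, ip_smul_right, h.symm]
    have hpos : 0 ≤ (a : ℂ) • ip w w := by
      rw [Complex.coe_smul]
      exact smul_nonneg ha (ip_self_nonneg w)
    calc ‖w‖ * ((C ^ 2)⁻¹ * ‖w‖) = (C ^ 2)⁻¹ * ‖w‖ ^ 2 := by ring
      _ ≤ (C ^ 2)⁻¹ * (C * ‖S w‖) ^ 2 := by gcongr; exact hS y
      _ = ‖S w‖ ^ 2 := by field_simp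
      _ = ‖ip (S w) (S w)‖ := norm_sq _
      _ ≤ ‖ip w (T (S w) + (a : ℂ) • w)‖ := by
        rw [e]
        exact CStarAlgebra.norm_le_norm_of_nonneg_of_le (ip_self_nonneg _)
          (le_add_of_nonneg_right hpos)
      _ ≤ _ := norm_ip_le _ _
  obtain ⟨z, hz⟩ := surjective_of_bounded_below (by positivity) hbelow ⟨T x, x, rfl⟩
  exact ⟨z, congrArg Subtype.val hz⟩

theorem apply_mem_orth_ker (h : IsAdjointPair T S) (z : StdModule A) :
    S z ∈ orth (LinearMap.ker T.toLinearMap) := by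
  rw [h.symm.ker_eq_orth_range]
  exact le_orth_orth _ ⟨z, rfl⟩

theorem isOrthCompl_ker (h : IsAdjointPair T S) (hT : IsClosed (Set.range T)) :
    IsOrthCompl (LinearMap.ker T.toLinearMap) := fun x => by
  obtain ⟨z, hz⟩ := h.exists_apply_adjoint_eq hT x
  refine ⟨x - S z, ?_, ?_⟩
  · change T (x - S z) = 0
    rw [map_sub, hz, sub_self]
  · rw [sub_sub_cancel]
    exact h.apply_mem_orth_ker z

theorem range_eq_orth_ker (h : IsAdjointPair T S) (hT : IsClosed (Set.range T)) :
    LinearMap.range S.toLinearMap = orth (LinearMap.ker T.toLinearMap) := by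
  refine le_antisymm ?_ fun x hx => ?_
  · rintro _ ⟨z, rfl⟩
    exact h.apply_mem_orth_ker z
  · obtain ⟨z, hz⟩ := h.exists_apply_adjoint_eq hT x
    refine ⟨z, ?_⟩
    have h1 : S z - x ∈ LinearMap.ker T.toLinearMap := by
      change T (S z - x) = 0
      rw [map_sub, hz, sub_self]
    exact sub_eq_zero.1
      (eq_zero_of_mem_orth h1 (Submodule.sub_mem _ (h.apply_mem_orth_ker z) hx))

/-- Im S = (ker T)^⊥ is closed, so T and S may be exchanged: Im T = (ker S)^⊥, the complement of a
complemented submodule. -/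
theorem isOrthCompl_range (h : IsAdjointPair T S) (hT : IsClosed (Set.range T)) :
    IsOrthCompl (LinearMap.range T.toLinearMap) := by
  have hS : IsClosed (Set.range S) := by
    have := isClosed_orth (LinearMap.ker T.toLinearMap)
    rwa [← h.range_eq_orth_ker hT] at this
  rw [h.symm.range_eq_orth_ker hS]
  exact (h.symm.isOrthCompl_ker hS).orth

end IsAdjointPair

theorem IsOrthCompl.isAdjointPair_proj {L : Submodule (RightScalars A) (StdModule A)}
    (h : IsOrthCompl L) : IsAdjointPair h.proj h.proj := h.ip_orthProj

/-! ### Kernels and ranges of perturbed operators -/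

variable {T F : StdModule A →L[RightScalars A] StdModule A}

theorem isClosed_ker (T : StdModule A →L[RightScalars A] StdModule A) :
    IsClosed (LinearMap.ker T.toLinearMap : Set (StdModule A)) :=
  isClosed_singleton.preimage T.continuous

/-- F restricts to a bijection from (ker F)^⊥ onto Im F. -/
theorem fg_orth_ker (hF : IsOrthCompl (LinearMap.ker F.toLinearMap))
    (hFG : (LinearMap.range F.toLinearMap).FG) : (orth (LinearMap.ker F.toLinearMap)).FG := by
  refine Submodule.fg_of_fg_map_of_fg_inf_ker F.toLinearMap ?_ ?_
  · have : (orth (LinearMap.ker F.toLinearMap)).map F.toLinearMap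
        = LinearMap.range F.toLinearMap := by
      refine le_antisymm LinearMap.map_le_range ?_
      rintro _ ⟨x, rfl⟩
      refine ⟨_, hF.sub_orthProj_mem x, ?_⟩
      rw [map_sub, LinearMap.mem_ker.1 (hF.orthProj_mem x), sub_zero]
    rwa [this]
  · convert Submodule.fg_bot
    exact (Submodule.eq_bot_iff _).2 fun x hx => eq_zero_of_mem_orth hx.2 hx.1

theorem range_comp_proj {L : Submodule (RightScalars A) (StdModule A)} (hL : IsOrthCompl L)
    (T : StdModule A →L[RightScalars A] StdModule A) :
    LinearMap.range (T.comp hL.proj).toLinearMap = L.map T.toLinearMap := by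
  apply le_antisymm
  · rintro _ ⟨x, rfl⟩
    exact ⟨_, hL.orthProj_mem x, rfl⟩
  · rintro _ ⟨x, hx, rfl⟩
    exact ⟨x, congrArg T (IsOrthCompl.orthProj_of_mem hx)⟩

theorem isClosed_range_comp_proj {L : Submodule (RightScalars A) (StdModule A)}
    (hL : IsOrthCompl L) (h : IsClosed (T '' (L : Set (StdModule A)))) :
    IsClosed (Set.range (T.comp hL.proj)) := by
  convert h
  exact congrArg SetLike.coe (range_comp_proj hL T)

/-- T(L) is the range of T composed with the projection onto L, which is again adjointable. -/
theorem isOrthCompl_map {L : Submodule (RightScalars A) (StdModule A)} (hL : IsOrthCompl L)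
    (hT : IsAdjointable T) (h : IsClosed (T '' (L : Set (StdModule A)))) :
    IsOrthCompl (L.map T.toLinearMap) := by
  obtain ⟨S, hS⟩ := hT
  rw [← range_comp_proj hL T]
  exact (IsAdjointPair.comp hS hL.isAdjointPair_proj).isOrthCompl_range
    (isClosed_range_comp_proj hL h)

/-- The kernel of T composed with the projection onto L is complemented. Splitting the L-component
of x along it gives the required decomposition. -/
theorem isOrthCompl_ker_inf {L : Submodule (RightScalars A) (StdModule A)} (hL : IsOrthCompl L)
    (hT : IsAdjointable T) (h : IsClosed (T '' (L : Set (StdModule A)))) :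
    IsOrthCompl (LinearMap.ker T.toLinearMap ⊓ L) := by
  obtain ⟨S, hS⟩ := hT
  have hK := (IsAdjointPair.comp hS hL.isAdjointPair_proj).isOrthCompl_ker
    (isClosed_range_comp_proj hL h)
  intro x
  set y := orthProj L x with hy
  have hyL : y ∈ L := hL.orthProj_mem x
  obtain ⟨u, hu, hv⟩ := hK y
  -- That kernel contains L^⊥, so y - u lies in L^⊥⊥ = L.
  have huL : u ∈ L := by
    have : y - u ∈ orth (orth L) := orth_anti (fun z hz => ?_) hv
    · rw [hL.orth_orth] at this
      simpa using L.sub_mem hyL this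
    · change T (orthProj L z) = 0
      rw [IsOrthCompl.orthProj_of_mem_orth hz, map_zero]
  refine ⟨u, ⟨?_, huL⟩, ?_⟩
  · have : T (orthProj L u) = 0 := hu
    rwa [IsOrthCompl.orthProj_of_mem huL] at this
  · rw [← sub_add_sub_cancel x y u]
    refine Submodule.add_mem _ (orth_anti inf_le_right (hL.sub_orthProj_mem x))
      (orth_anti ?_ hv)
    rintro z ⟨hz, hzL⟩
    change T (orthProj L z) = 0
    rw [IsOrthCompl.orthProj_of_mem hzL]
    exact hz

/-- If `F` has finitely generated range, then up to finitely generated summands the kernel of `T`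
is the kernel of its restriction to `ker F`, and the complement of the range of `T` is the
complement of the range of this restriction. -/
theorem exists_ker_equiv_and_orth_equiv (hT : IsAdjointable T) (hT_range : IsClosed (Set.range T))
    (hF : IsAdjointable F) (hF_range : IsFGHilbertSubmodule (LinearMap.range F.toLinearMap))
    (h_image : IsClosed (T '' (LinearMap.ker F.toLinearMap : Set (StdModule A))))
    (h_proj : IsClosed (orthProj (orth (LinearMap.ker F.toLinearMap)) ''
      (LinearMap.ker T.toLinearMap : Set (StdModule A)))) :
    ∃ R M : Submodule (RightScalars A) (StdModule A),
      IsFGHilbertSubmodule R ∧ IsFGHilbertSubmodule M ∧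
      Nonempty (LinearMap.ker T.toLinearMap ≃L[RightScalars A]
        (LinearMap.ker T.toLinearMap ⊓ LinearMap.ker F.toLinearMap :
          Submodule (RightScalars A) (StdModule A)) × R) ∧
      Nonempty (orth ((LinearMap.ker F.toLinearMap).map T.toLinearMap) ≃L[RightScalars A]
        M × orth (LinearMap.range T.toLinearMap)) := by
  obtain ⟨S, hS : IsAdjointPair T S⟩ := id hT
  obtain ⟨G, hG : IsAdjointPair F G⟩ := hF
  have hkF : IsOrthCompl (LinearMap.ker F.toLinearMap) := hG.isOrthCompl_ker hF_range.1
  have hkT : IsOrthCompl (LinearMap.ker T.toLinearMap) := hS.isOrthCompl_ker hT_range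
  have hrT : IsOrthCompl (LinearMap.range T.toLinearMap) := hS.isOrthCompl_range hT_range
  have hFG := fg_orth_ker hkF hF_range.2
  have hK := isOrthCompl_ker_inf hkF hT h_image
  have hL := isOrthCompl_map hkF hT h_image
  set kF := LinearMap.ker F.toLinearMap with kF_def
  set kT := LinearMap.ker T.toLinearMap with kT_def
  set L := kF.map T.toLinearMap with L_def
  refine ⟨kT ⊓ orth (kT ⊓ kF), orth L ⊓ orth (orth (LinearMap.range T.toLinearMap)),
    ⟨(isClosed_ker T).inter (isClosed_orth _), ?_⟩,
    ⟨(isClosed_orth _).inter (isClosed_orth _), ?_⟩,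
    ⟨hK.splitting inf_le_left⟩,
    ⟨(hrT.orth.splitting (orth_anti LinearMap.map_le_range)).trans
      (ContinuousLinearEquiv.prodComm _ _ _)⟩⟩
  · refine Submodule.fg_of_fg_map_of_fg_inf_ker hkF.orth.proj.toLinearMap ?_ ?_
    -- Removing from x ∈ ker T its component in ker T ∩ ker F does not change its projection to (ker
    -- F)^⊥.
    · have hmap : (kT ⊓ orth (kT ⊓ kF)).map hkF.orth.proj.toLinearMap
          = kT.map hkF.orth.proj.toLinearMap := by
        refine le_antisymm (Submodule.map_mono inf_le_left) ?_
        rintro _ ⟨x, hx, rfl⟩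
        have hm := hK.orthProj_mem x
        refine ⟨x - orthProj (kT ⊓ kF) x, ⟨kT.sub_mem hx hm.1, hK.sub_orthProj_mem x⟩, ?_⟩
        rw [map_sub, sub_eq_self]
        exact IsOrthCompl.orthProj_of_mem_orth (le_orth_orth _ hm.2)
      rw [hmap]
      refine (isOrthCompl_map hkT ⟨_, hkF.orth.isAdjointPair_proj⟩ h_proj).fg_of_le ?_ hFG
      rintro _ ⟨x, -, rfl⟩
      exact hkF.orth.orthProj_mem x
    · convert Submodule.fg_bot
      refine (Submodule.eq_bot_iff _).2 fun x hx => eq_zero_of_mem_orth (L := kT ⊓ kF) ?_ hx.1.2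
      refine ⟨hx.1.1, ?_⟩
      have h0 : orthProj (orth kF) x = 0 := hx.2
      have := hkF.orth.sub_orthProj_mem x
      rwa [h0, sub_zero, hkF.orth_orth] at this
  · rw [hrT.orth_orth]
    -- Projecting to L^⊥ kills T(ker F) = L, so only (ker F)^⊥ contributes; the image stays in Im T
    -- because L ⊆ Im T.
    have hmap : orth L ⊓ LinearMap.range T.toLinearMap
        = (orth kF).map (hL.orth.proj.comp T).toLinearMap := by
      apply le_antisymm
      · rintro _ ⟨hy, x, rfl⟩
        refine ⟨_, hkF.sub_orthProj_mem x, ?_⟩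
        change orthProj (orth L) (T (x - orthProj kF x)) = T x
        rw [← hL.orth.proj_apply, map_sub, map_sub, hL.orth.proj_apply, hL.orth.proj_apply,
          IsOrthCompl.orthProj_of_mem (show T x ∈ orth L from hy),
          IsOrthCompl.orthProj_of_mem_orth, sub_zero]
        exact le_orth_orth _ ⟨_, hkF.orthProj_mem x, rfl⟩
      · rintro _ ⟨x, -, rfl⟩
        refine ⟨hL.orth.orthProj_mem _, ?_⟩
        change orthProj (orth L) (T x) ∈ _
        rw [hL.orthProj_orth]
        exact Submodule.sub_mem _ ⟨x, rfl⟩ (LinearMap.map_le_range (hL.orthProj_mem _))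
    rw [hmap]
    exact hFG.map _

/-! ### External direct sums of finitely generated submodules -/

/-- Interleaving sequences on even and odd indices identifies `H_A` with two copies of itself, so an
external sum can be realized inside `H_A`. -/
theorem exists_fg_equiv_prod {N₁ N₂ : Submodule (RightScalars A) (StdModule A)}
    (h₁ : IsFGHilbertSubmodule N₁) (h₂ : IsFGHilbertSubmodule N₂) :
    ∃ N : Submodule (RightScalars A) (StdModule A), IsFGHilbertSubmodule N ∧
      Nonempty ((N₁ × N₂) ≃L[RightScalars A] N) := by
  have he : Function.Injective fun n : ℕ => 2 * n := fun a b h => by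
    simpa using h
  have ho : Function.Injective fun n : ℕ => 2 * n + 1 := fun a b h => by
    simpa using h
  have hc₁ := continuous_select (A := A) he
  have hc₂ := continuous_select (A := A) ho
  have hd₁ := continuous_spread (A := A) he
  have hd₂ := continuous_spread (A := A) ho
  have heo : ∀ x : StdModule A, select ho (spread he x) = 0 := fun x => by
    ext n
    exact spread_apply_of_notMem he x (by rintro ⟨m, hm⟩; dsimp only at hm; omega)
  have hoe : ∀ x : StdModule A, select he (spread ho x) = 0 := fun x => by
    ext n
    exact spread_apply_of_notMem ho x (by rintro ⟨m, hm⟩; dsimp only at hm; omega)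
  have hsum : ∀ x : StdModule A, spread he (select he x) + spread ho (select ho x) = x := by
    intro x
    ext n
    rw [StdModule.add_apply]
    rcases Nat.even_or_odd' n with ⟨m, rfl | rfl⟩
    · rw [spread_apply_self he, spread_apply_of_notMem ho _
          (by rintro ⟨k, hk⟩; dsimp only at hk; omega),
        add_zero, select_apply]
    · rw [spread_apply_self ho, spread_apply_of_notMem he _
          (by rintro ⟨k, hk⟩; dsimp only at hk; omega),
        zero_add, select_apply]
  refine ⟨N₁.comap (select he) ⊓ N₂.comap (select ho),
    ⟨(h₁.1.preimage hc₁).inter (h₂.1.preimage hc₂), ?_⟩, ⟨?_⟩⟩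
  · have : N₁.comap (select he) ⊓ N₂.comap (select ho)
        = N₁.map (spread he) ⊔ N₂.map (spread ho) := by
      apply le_antisymm
      · rintro x ⟨hx₁, hx₂⟩
        rw [← hsum x]
        exact Submodule.add_mem_sup ⟨_, hx₁, rfl⟩ ⟨_, hx₂, rfl⟩
      · refine sup_le ?_ ?_ <;> rintro _ ⟨x, hx, rfl⟩
        · exact ⟨by simpa using hx, by simp [heo]⟩
        · exact ⟨by simp [hoe], by simpa using hx⟩
    rw [this]
    exact (h₁.2.map _).sup (h₂.2.map _)
  · exact
    { toFun := fun p => ⟨spread he p.1 + spread ho p.2, by simp [hoe], by simp [heo]⟩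
      invFun := fun x => (⟨select he x, x.2.1⟩, ⟨select ho x, x.2.2⟩)
      map_add' := fun p q => Subtype.ext (by simp [add_add_add_comm])
      map_smul' := fun r p => Subtype.ext (by simp)
      left_inv := fun p => by
        ext1 <;> apply Subtype.ext <;> simp [hoe, heo]
      right_inv := fun x => Subtype.ext (hsum x)
      continuous_toFun := by fun_prop
      continuous_invFun := by fun_prop }

theorem exists_fg_equiv_prod₃ {N₁ N₂ N₃ : Submodule (RightScalars A) (StdModule A)}
    (h₁ : IsFGHilbertSubmodule N₁) (h₂ : IsFGHilbertSubmodule N₂) (h₃ : IsFGHilbertSubmodule N₃) :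
    ∃ N : Submodule (RightScalars A) (StdModule A), IsFGHilbertSubmodule N ∧
      Nonempty (((N₁ × N₂) × N₃) ≃L[RightScalars A] N) := by
  obtain ⟨N, hN, ⟨e⟩⟩ := exists_fg_equiv_prod h₁ h₂
  obtain ⟨N', hN', ⟨e'⟩⟩ := exists_fg_equiv_prod hN h₃
  exact ⟨N', hN', ⟨(e.prodCongr (.refl _ _)).trans e'⟩⟩

section Rearrangement

variable (R : Type*) [Semiring R] (E₁ E₂ E₃ E₄ E₅ : Type*)
  [AddCommMonoid E₁] [Module R E₁] [TopologicalSpace E₁]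
  [AddCommMonoid E₂] [Module R E₂] [TopologicalSpace E₂]
  [AddCommMonoid E₃] [Module R E₃] [TopologicalSpace E₃]
  [AddCommMonoid E₄] [Module R E₄] [TopologicalSpace E₄]
  [AddCommMonoid E₅] [Module R E₅] [TopologicalSpace E₅]

/-- A rearrangement of the summands of a direct sum. -/
def prodRearrangeLeft :
    (((E₁ × E₂) × E₃) × E₄ × E₅) ≃L[R] ((E₁ × E₄ × E₂) × E₃) × E₅ where
  toFun p := (((p.1.1.1, p.2.1, p.1.1.2), p.1.2), p.2.2)
  invFun p := (((p.1.1.1, p.1.1.2.2), p.1.2), p.1.1.2.1, p.2)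
  map_add' _ _ := rfl
  map_smul' _ _ := rfl
  left_inv _ := rfl
  right_inv _ := rfl
  continuous_toFun := by fun_prop
  continuous_invFun := by fun_prop

/-- A rearrangement of the summands of a direct sum. -/
def prodRearrangeMiddle :
    (((E₁ × E₂) × E₃) × E₄) ≃L[R] (E₁ × E₃ × E₂) × E₄ where
  toFun p := ((p.1.1.1, p.1.2, p.1.1.2), p.2)
  invFun p := (((p.1.1, p.1.2.2), p.1.2.1), p.2)
  map_add' _ _ := rfl
  map_smul' _ _ := rfl
  left_inv _ := rfl
  right_inv _ := rfl
  continuous_toFun := by fun_prop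
  continuous_invFun := by fun_prop

/-- A rearrangement of the summands of a direct sum. -/
def prodRearrangeRight :
    ((E₁ × E₂ × E₃) × E₄) ≃L[R] ((E₁ × E₄) × E₂) × E₃ where
  toFun p := (((p.1.1, p.2), p.1.2.1), p.1.2.2)
  invFun p := ((p.1.1.1, p.1.2, p.2), p.1.1.2)
  map_add' _ _ := rfl
  map_smul' _ _ := rfl
  left_inv _ := rfl
  right_inv _ := rfl
  continuous_toFun := by fun_prop
  continuous_invFun := by fun_prop

end Rearrangement

theorem IsAdjointable.add (hT : IsAdjointable T) (hF : IsAdjointable F) :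
    IsAdjointable (T + F) := by
  obtain ⟨S, hS⟩ := hT
  obtain ⟨G, hG⟩ := hF
  exact ⟨S + G, IsAdjointPair.add hS hG⟩

end HilbertModule
end

/-! ### Stability under the perturbation -/

open HilbertModule in
theorem mainTheorem7 {A : Type*} [NonUnitalCStarAlgebra A]
    (T F : StdModule A →L[RightScalars A] StdModule A)
    (hT : IsGenWeyl T)
    (hF : IsAdjointable F)
    (hF_range : IsFGHilbertSubmodule (LinearMap.range F.toLinearMap))
    (h_range : IsClosed (Set.range (T + F)))
    (h_image : IsClosed (T '' (LinearMap.ker F.toLinearMap : Set (StdModule A))))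
    (h_proj : IsClosed (orthProj (orth (LinearMap.ker F.toLinearMap)) ''
      (LinearMap.ker T.toLinearMap : Set (StdModule A))))
    (h_proj_add : IsClosed (orthProj (orth (LinearMap.ker F.toLinearMap)) ''
      (LinearMap.ker (T + F).toLinearMap : Set (StdModule A)))) :
    IsGenWeyl (T + F) := by
  obtain ⟨hTa, hTr, N, N', hN, hN', ⟨e⟩⟩ := hT
  have hTF : ∀ x ∈ LinearMap.ker F.toLinearMap, (T + F) x = T x := fun x hx => by
    have : F x = 0 := hx
    simp [this]
  have h_image' :
      IsClosed ((T + F) '' (LinearMap.ker F.toLinearMap : Set (StdModule A))) := by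
    rwa [Set.image_congr hTF]
  have hK : LinearMap.ker (T + F).toLinearMap ⊓ LinearMap.ker F.toLinearMap
      = LinearMap.ker T.toLinearMap ⊓ LinearMap.ker F.toLinearMap := by
    ext x
    refine and_congr_left fun hx => ?_
    change (T + F) x = 0 ↔ T x = 0
    rw [hTF x hx]
  have hL : (LinearMap.ker F.toLinearMap).map (T + F).toLinearMap
      = (LinearMap.ker F.toLinearMap).map T.toLinearMap :=
    SetLike.coe_injective (Set.image_congr hTF)
  obtain ⟨R, M, hR, hM, ⟨eR⟩, ⟨eM⟩⟩ :=
    exists_ker_equiv_and_orth_equiv hTa hTr hF hF_range h_image h_proj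
  obtain ⟨R', M', hR', hM', eR', eM'⟩ :=
    exists_ker_equiv_and_orth_equiv (hTa.add hF) h_range hF hF_range h_image' h_proj_add
  rw [hK] at eR'
  rw [hL] at eM'
  obtain ⟨⟨eR'⟩, ⟨eM'⟩⟩ := And.intro eR' eM'
  obtain ⟨X, hX, ⟨eX⟩⟩ := exists_fg_equiv_prod₃ hN hR hM
  obtain ⟨Y, hY, ⟨eY⟩⟩ := exists_fg_equiv_prod₃ hN' hR' hM'
  refine ⟨hTa.add hF, h_range, X, Y, hX, hY, ⟨?_⟩⟩
  let S := RightScalars A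
  -- Split ker(T+F), trade its common part with R for ker T, apply e, trade M ⊕ (Im T)^⊥ for M' ⊕
  -- (Im(T+F))^⊥ through T(ker F)^⊥, and collect N', R', M' into Y.
  exact (eX.symm.prodCongr eR').trans <|
    (prodRearrangeLeft S N R M _ R').trans <|
    (((((ContinuousLinearEquiv.refl S N).prodCongr eR.symm).trans e).prodCongr
      (.refl S M)).prodCongr (.refl S R')).trans <|
    (prodRearrangeMiddle S N' _ M R').trans <|
    (((ContinuousLinearEquiv.refl S N').prodCongr (eM.symm.trans eM')).prodCongr
      (.refl S R')).trans <|
    (prodRearrangeRight S N' M' _ R').trans <|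
    eY.prodCongr (.refl S _)
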